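/- All graphs are finite and simple. Let $G=(V,E)$ be a graph with $n=|V|$ vertices and $m=|E|$ edges. For an orientation of $G$, let $A_G$ be the real matrix with rows indexed by $E$ and columns indexed by $V\cup E$ in which, for an edge $e$ oriented from $u$ to $v$, $A_G[e,y]=1$ if $y=v$ or $y\neq e$ is an edge incident to $v$; $A_G[e,y]=-1$ if $y=u$ or $y\neq e$ is an edge incident to $u$; and $A_G[e,y]=0$ otherwise. The permanent index $\mathrm{pind}(A)$ of a matrix $A$ is the minimum $k$ for which there is a square matrix $A'$ with $\mathrm{per}(A')\neq 0$ such that each column of $A'$ is a column of $A$ and each column of $A$ (columns being distinguished by their indices) occurs in $A'$ at most $k$ times; it is $\infty$ if there is no such $k$. The graph $G$ is $(2,2)$-choosable if, whenever each $z\in V\cup E$ is assigned a set $L(z)$ of two real numbers, there is $f:V\cup E\to\mathbb{R}$ with $f(z)\in L(z)$ for all $z$ such that $s(u)\neq s(v)$ for every two adjacent vertices $u,v$, where $s(v)=f(v)+\sum_{e\ni v}f(e)$. A unicyclic graph is a connected graph containing exactly one cycle. **Theorem.** For every unicyclic graph $U$ and every orientation of $U$, $\mathrm{pind}(A_U)=1$,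 and $U$ is $(2,2)$-choosable. Hence every connected graph with $m=n$ is $(2,2)$-choosable. -/

import Mathlib

/-- An orientation of a graph: each edge is directed from `source e` to `target e`. -/
structure GraphOrientation {V : Type*} (G : SimpleGraph V) where
  source : G.edgeSet → V
  target : G.edgeSet → V
  mk_eq : ∀ e : G.edgeSet, s(source e, target e) = (e : Sym2 V)

/-- The matrix `A_G` of an oriented graph: rows are indexed by the edges, columns by the vertices
and the edges. In row `e = (u, v)` the entry is `1` at `v` and at the other edges incident to `v`,
`-1` at `u` and at the other edges incident to `u`, and `0` elsewhere. -/
def totalWeightMatrix {V : Type*} [DecidableEq V] {G : SimpleGraph V} (D : GraphOrientation G) :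
    Matrix G.edgeSet (V ⊕ G.edgeSet) ℝ :=
  Matrix.of fun e z =>
    match z with
    | Sum.inl w => if w = D.target e then 1 else if w = D.source e then -1 else 0
    | Sum.inr y =>
        if y ≠ e ∧ D.target e ∈ (y : Sym2 V) then 1
        else if y ≠ e ∧ D.source e ∈ (y : Sym2 V) then -1
        else 0

/-- The permanent index of a matrix `A`: the least `k` such that some square matrix with nonzero
permanent has all its columns among the columns of `A`, each column (index) of `A` being used
at most `k` times. The column of `A` in position `i` of the square matrix is `A`'s column `f i`.
The value is `⊤` if there is no such `k`. -/
noncomputable def permanentIndex {m c : Type*} [Fintype m] [DecidableEq m] [DecidableEq c]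
    (A : Matrix m c ℝ) : ℕ∞ :=
  sInf {k : ℕ∞ | ∃ f : m → c, (A.submatrix id f).permanent ≠ 0 ∧
    ∀ z : c, ((Finset.univ.filter fun i => f i = z).card : ℕ∞) ≤ k}

/-- The total weight `s(v) = f(v) + ∑ f(e)`, over the edges `e` incident to `v`. -/
noncomputable def vertexWeight {V : Type*} [DecidableEq V] {G : SimpleGraph V}
    [Fintype G.edgeSet] (f : V ⊕ G.edgeSet → ℝ) (v : V) : ℝ :=
  f (Sum.inl v) + ∑ e : G.edgeSet, if v ∈ (e : Sym2 V) then f (Sum.inr e) else 0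

/-- A total weighting is proper if adjacent vertices have distinct weights. -/
def IsProperTotalWeighting {V : Type*} [DecidableEq V] {G : SimpleGraph V}
    [Fintype G.edgeSet] (f : V ⊕ G.edgeSet → ℝ) : Prop :=
  ∀ u v : V, G.Adj u v → vertexWeight f u ≠ vertexWeight f v

/-- Total weight `ψ`-choosability. -/
def TotalWeightChoosable {V : Type*} [DecidableEq V] (G : SimpleGraph V)
    [Fintype G.edgeSet] (ψ : V ⊕ G.edgeSet → ℕ+) : Prop :=
  ∀ L : V ⊕ G.edgeSet → Finset ℝ, (∀ z, (L z).card = ψ z) →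
    ∃ f : V ⊕ G.edgeSet → ℝ, IsProperTotalWeighting f ∧ ∀ z, f z ∈ L z

/-- Total weight `(k, k')`-choosability: lists of size `k` on vertices and `k'` on edges. -/
def TotalWeightPairChoosable {V : Type*} [DecidableEq V] (G : SimpleGraph V)
    [Fintype G.edgeSet] (k k' : ℕ+) : Prop :=
  TotalWeightChoosable G (Sum.elim (fun _ => k) (fun _ => k'))

/-- A unicyclic graph: connected, and containing exactly one cycle (as a subgraph). -/
def IsUnicyclic {V : Type*} (G : SimpleGraph V) : Prop :=
  G.Connected ∧
    ∃! H : G.Subgraph, ∃ (v : V) (c : G.Walk v v), c.IsCycle ∧ c.toSubgraph = H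

/-!
Let `e₀` be an edge of `G` such that `G - e₀` is a forest, and root `G - e₀` so that the source of
`e₀` is a root. Represent each edge other than `e₀` by the column of its child, and `e₀` by the
column of its target. When the edges are ordered by the height of their representatives, the
resulting square matrix is triangular except that the target of `e₀` may also be the child of an
edge, in which case two columns agree. All nonzero terms of the permanent are therefore equal to the
product of the diagonal entries, and the permanent does not vanish. The column of `e₀` is the sum of
the columns of its ends, so by additivity the permanent remains nonzero when the column of the
target is replaced either by that of the source or by that of `e₀`, and then no column is repeated.

A permanent with columns from `A` is a positive multiple of a coefficient of the product of the
linear forms given by the rows of `A`. The combinatorial Nullstellensatz turns its nonvanishing into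
a choice of weights at which no row form vanishes, and the form of the row of `e` is the difference
of the total weights of the ends of `e`.
-/

section Permanent

theorem submatrix_id_update {m n c R : Type*} [DecidableEq m] (A : Matrix n c R)
    (f : m → c) (j : m) (z : c) :
    A.submatrix id (Function.update f j z) = (A.submatrix id f).updateCol j (A.col z) := by
  ext i k
  obtain rfl | hk := eq_or_ne k j <;> simp [*]

theorem not_lt_perm_apply_of_forall_le_perm_apply {m α : Type*} [Finite m] [Preorder α] {r : m → α}
    {σ : Equiv.Perm m} (hσ : ∀ i, r i ≤ r (σ i)) (i : m) : ¬ r i < r (σ i) := by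
  have hpow (k : ℕ) : ∀ i, r i ≤ r ((σ ^ k) i) := by
    induction k with
    | zero => exact fun i => le_rfl
    | succ k ih => exact fun i => (hσ i).trans (ih (σ i))
  have hback : (σ ^ (orderOf σ - 1)) (σ i) = i := by
    rw [← Equiv.Perm.mul_apply, ← pow_succ, Nat.sub_add_cancel (orderOf_pos σ),
      pow_orderOf_eq_one, Equiv.Perm.one_apply]
  exact fun hlt => hlt.not_ge ((hpow (orderOf σ - 1) (σ i)).trans_eq (congrArg r hback))

variable {m R : Type*} [Fintype m] [DecidableEq m] [CommSemiring R]

theorem permanent_updateCol_add (M : Matrix m m R) (j : m) (u v : m → R) :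
    (M.updateCol j (u + v)).permanent =
      (M.updateCol j u).permanent + (M.updateCol j v).permanent := by
  have hprod (w : m → R) (σ : Equiv.Perm m) : ∏ i, M.updateCol j w (σ i) i =
      w (σ j) * ∏ i ∈ Finset.univ.erase j, M (σ i) i := by
    rw [← Finset.mul_prod_erase _ _ (Finset.mem_univ j), Matrix.updateCol_self]
    congr 1
    exact Finset.prod_congr rfl fun i hi => Matrix.updateCol_ne (Finset.ne_of_mem_erase hi)
  simp only [Matrix.permanent, hprod, Pi.add_apply, add_mul, Finset.sum_add_distrib]

theorem permanent_ne_zero_of_rank_lt_or_col_eq [NoZeroDivisors R] [CharZero R]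
    {α : Type*} [Preorder α] (M : Matrix m m R) (rank : m → α) (hdiag : ∀ i, M i i ≠ 0)
    (hrank : ∀ i j, M i j ≠ 0 → rank j < rank i ∨ rank j = rank i ∧ M.col j = M.col i) :
    M.permanent ≠ 0 := by
  classical
  have hterm (σ : Equiv.Perm m) (hσ : ∀ i, M (σ i) i ≠ 0) :
      ∏ i, M (σ i) i = ∏ i, M i i := by
    have hle (i : m) : rank i ≤ rank (σ i) :=
      (hrank _ _ (hσ i)).elim le_of_lt fun h => h.1.le
    have hcol (i : m) : M.col i = M.col (σ i) :=
      ((hrank _ _ (hσ i)).resolve_left (not_lt_perm_apply_of_forall_le_perm_apply hle i)).2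
    rw [← Equiv.prod_comp σ fun i => M i i]
    exact Finset.prod_congr rfl fun i _ => congrFun (hcol i) (σ i)
  have hsum : M.permanent =
      Finset.card {σ : Equiv.Perm m | ∀ i, M (σ i) i ≠ 0} * ∏ i, M i i := by
    rw [← nsmul_eq_mul, ← Finset.sum_const, Finset.sum_filter, Matrix.permanent]
    refine Finset.sum_congr rfl fun σ _ => ?_
    split_ifs with hσ
    · exact hterm σ hσ
    · obtain ⟨i, hi⟩ := not_forall_not.mp hσ
      exact Finset.prod_eq_zero (Finset.mem_univ i) hi
  have hone : 1 ∈ ({σ : Equiv.Perm m | ∀ i, M (σ i) i ≠ 0} : Finset _) := by simpa using hdiag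
  rw [hsum]
  exact mul_ne_zero (Nat.cast_ne_zero.mpr (Finset.card_ne_zero_of_mem hone))
    (Finset.prod_ne_zero_iff.mpr fun i _ => hdiag i)

end Permanent

section PermanentLemma

variable {m c R : Type*} [Fintype m]

theorem sum_single_one_apply [DecidableEq c] (f : m → c) (z : c) :
    (∑ i, Finsupp.single (f i) 1 : c →₀ ℕ) z = Finset.card {i | f i = z} := by
  simp [Finsupp.finsetSum_apply, Finsupp.single_apply]

theorem exists_perm_comp_eq_of_sum_single_eq {f g : m → c}
    (h : (∑ i, Finsupp.single (g i) 1 : c →₀ ℕ) = ∑ i, Finsupp.single (f i) 1) :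
    ∃ σ : Equiv.Perm m, f ∘ σ = g := by
  classical
  have hfiber (z : c) : Nonempty ({i // g i = z} ≃ {i // f i = z}) := by
    rw [← Fintype.card_eq]
    simpa only [Fintype.card_subtype, sum_single_one_apply] using DFunLike.congr_fun h z
  exact ⟨Equiv.ofFiberEquiv fun z => (hfiber z).some,
    funext (Equiv.ofFiberEquiv_map fun z => (hfiber z).some)⟩

theorem coeff_prod_toMvPolynomial [CommSemiring R] [Fintype c] [DecidableEq m] [DecidableEq c]
    (A : Matrix m c R) (t : c →₀ ℕ) :
    (∏ i, A.toMvPolynomial i).coeff t =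
      ∑ g : m → c with ∑ i, Finsupp.single (g i) 1 = t, ∏ i, A i (g i) := by
  simp only [Matrix.toMvPolynomial, Fintype.prod_sum, ← MvPolynomial.monomial_sum_prod,
    MvPolynomial.coeff_sum, MvPolynomial.coeff_monomial, Finset.sum_filter]

theorem permanent_submatrix_eq_card_nsmul_coeff [CommSemiring R] [Fintype c] [DecidableEq m]
    [DecidableEq c] (A : Matrix m c R) (f : m → c) :
    (A.submatrix id f).permanent = Finset.card {σ : Equiv.Perm m | f ∘ σ = f} •
      (∏ i, A.toMvPolynomial i).coeff (∑ i, Finsupp.single (f i) 1) := by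
  have hfiber (τ : Equiv.Perm m) : Finset.card {σ : Equiv.Perm m | f ∘ σ = f ∘ τ} =
      Finset.card {σ : Equiv.Perm m | f ∘ σ = f} := by
    refine Finset.card_equiv (Equiv.mulRight τ⁻¹) fun σ => ?_
    simp only [Finset.mem_filter_univ, Equiv.coe_mulRight, Equiv.Perm.coe_mul,
      ← Function.comp_assoc]
    exact (Equiv.comp_symm_eq τ f (f ∘ σ)).symm
  have himage : Finset.univ.image (fun σ : Equiv.Perm m => f ∘ σ) =
      ({g | ∑ i, Finsupp.single (g i) 1 = ∑ i, Finsupp.single (f i) 1} : Finset (m → c)) := by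
    ext g
    simp only [Finset.mem_image, Finset.mem_univ, true_and, Finset.mem_filter]
    refine ⟨?_, exists_perm_comp_eq_of_sum_single_eq⟩
    rintro ⟨σ, rfl⟩
    exact Equiv.sum_comp σ fun i => Finsupp.single (f i) 1
  calc (A.submatrix id f).permanent
      = ∑ σ : Equiv.Perm m, ∏ i, A i ((f ∘ σ) i) := by
        rw [← Matrix.permanent_transpose]
        rfl
    _ = ∑ g ∈ Finset.univ.image (fun σ : Equiv.Perm m => f ∘ σ),
          Finset.card {σ : Equiv.Perm m | f ∘ σ = g} • ∏ i, A i (g i) :=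
        Finset.sum_comp (fun g => ∏ i, A i (g i)) fun σ : Equiv.Perm m => f ∘ σ
    _ = ∑ g ∈ Finset.univ.image (fun σ : Equiv.Perm m => f ∘ σ),
          Finset.card {σ : Equiv.Perm m | f ∘ σ = f} • ∏ i, A i (g i) :=
        Finset.sum_congr rfl fun g hg => by
          obtain ⟨τ, -, rfl⟩ := Finset.mem_image.mp hg
          rw [hfiber]
    _ = _ := by rw [← Finset.smul_sum, himage, coeff_prod_toMvPolynomial]

/-- The permanent lemma of Alon. -/
theorem exists_forall_mulVec_ne_zero_of_permanent_ne_zero [CommRing R] [IsDomain R] [Fintype c]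
    [DecidableEq m] [DecidableEq c] (A : Matrix m c R) {f : m → c}
    (hf : (A.submatrix id f).permanent ≠ 0) (L : c → Finset R)
    (hL : ∀ z, Finset.card {i | f i = z} < (L z).card) :
    ∃ x : c → R, (∀ z, x z ∈ L z) ∧ ∀ i, (A.mulVec x) i ≠ 0 := by
  set P : MvPolynomial c R := ∏ i, A.toMvPolynomial i with hP
  set t : c →₀ ℕ := ∑ i, Finsupp.single (f i) 1 with ht
  have hcoeff : P.coeff t ≠ 0 := fun h =>
    hf (by rw [permanent_submatrix_eq_card_nsmul_coeff, h, smul_zero])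
  have hhom : P.IsHomogeneous t.degree := by
    rw [ht, map_sum]
    exact MvPolynomial.IsHomogeneous.prod _ _ _ fun i _ => by
      simpa using A.toMvPolynomial_isHomogeneous i
  have hdeg : P.totalDegree = t.degree :=
    hhom.totalDegree (MvPolynomial.ne_zero_iff.mpr ⟨t, hcoeff⟩)
  obtain ⟨x, hx, hPx⟩ := MvPolynomial.combinatorial_nullstellensatz_exists_eval_nonzero P t hcoeff
    hdeg L fun z => (sum_single_one_apply f z).trans_lt (hL z)
  refine ⟨x, hx, fun i hi => hPx ?_⟩
  rw [hP, map_prod]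
  exact Finset.prod_eq_zero (Finset.mem_univ i)
    ((A.toMvPolynomial_eval_eq_apply i x).trans hi)

end PermanentLemma

section PermanentIndex

variable {m c : Type*} [Fintype m] [DecidableEq m] [DecidableEq c] {A : Matrix m c ℝ}

theorem exists_permanent_ne_zero_of_permanentIndex_lt {k : ℕ∞} (hk : permanentIndex A < k) :
    ∃ f : m → c, (A.submatrix id f).permanent ≠ 0 ∧
      ∀ z, (Finset.card {i | f i = z} : ℕ∞) < k := by
  obtain ⟨l, ⟨f, hf, hl⟩, hlk⟩ := sInf_lt_iff.mp hk
  exact ⟨f, hf, fun z => (hl z).trans_lt hlk⟩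

theorem one_le_permanentIndex [Nonempty m] : 1 ≤ permanentIndex A := by
  refine le_sInf ?_
  rintro k ⟨f, -, hk⟩
  obtain ⟨i⟩ := ‹Nonempty m›
  have hpos : 1 ≤ Finset.card {j | f j = f i} := Finset.card_pos.mpr ⟨i, by simp⟩
  exact le_trans (mod_cast hpos) (hk (f i))

theorem permanentIndex_le_one_of_injective {f : m → c} (hf : Function.Injective f)
    (hper : (A.submatrix id f).permanent ≠ 0) : permanentIndex A ≤ 1 := by
  refine sInf_le ⟨f, hper, fun z => ?_⟩
  have hcard : Finset.card {i | f i = z} ≤ 1 := Finset.card_le_one.mpr fun i hi j hj =>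
    hf (by rw [(Finset.mem_filter_univ i).mp hi, (Finset.mem_filter_univ j).mp hj])
  exact_mod_cast hcard

end PermanentIndex

section TotalWeightMatrix

variable {V : Type*} {G : SimpleGraph V}

theorem GraphOrientation.nonempty (G : SimpleGraph V) : Nonempty (GraphOrientation G) :=
  ⟨⟨fun e => (e : Sym2 V).out.1, fun e => (e : Sym2 V).out.2, fun _ => Quot.out_eq _⟩⟩

variable (D : GraphOrientation G)

theorem GraphOrientation.mem_iff {e : G.edgeSet} {v : V} :
    v ∈ (e : Sym2 V) ↔ v = D.source e ∨ v = D.target e := by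
  rw [← D.mk_eq e, Sym2.mem_iff]

theorem GraphOrientation.source_ne_target (e : G.edgeSet) : D.source e ≠ D.target e :=
  (show G.Adj (D.source e) (D.target e) by
    rw [← SimpleGraph.mem_edgeSet, D.mk_eq]; exact e.2).ne

theorem GraphOrientation.source_notMem_of_target_mem {e y : G.edgeSet} (hne : y ≠ e)
    (ht : D.target e ∈ (y : Sym2 V)) : D.source e ∉ (y : Sym2 V) := fun hs =>
  hne <| Subtype.ext <|
    ((Sym2.mem_and_mem_iff (D.source_ne_target e)).mp ⟨hs, ht⟩).trans (D.mk_eq e)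

variable [DecidableEq V]

/-- The incidence matrix between the vertices of `G` and its vertices and edges, a vertex being
incident to itself only: row `v` lists the elements whose weights add up to the total weight of
`v`, so that the rows of `A_G` are differences of rows of this matrix. -/
def totalIncidenceMatrix (G : SimpleGraph V) : Matrix V (V ⊕ G.edgeSet) ℝ :=
  Matrix.fromCols 1 (Matrix.of fun v e => if v ∈ (e : Sym2 V) then 1 else 0)

theorem totalIncidenceMatrix_inl (v w : V) :
    totalIncidenceMatrix G v (Sum.inl w) = if v = w then 1 else 0 :=
  Matrix.one_apply

theorem totalIncidenceMatrix_inr (v : V) (e : G.edgeSet) :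
    totalIncidenceMatrix G v (Sum.inr e) = if v ∈ (e : Sym2 V) then 1 else 0 :=
  rfl

theorem totalIncidenceMatrix_mulVec [Fintype V] [Fintype G.edgeSet] (f : V ⊕ G.edgeSet → ℝ) :
    (totalIncidenceMatrix G).mulVec f = vertexWeight f := by
  ext v
  simp [Matrix.mulVec, dotProduct, vertexWeight, totalIncidenceMatrix_inl, totalIncidenceMatrix_inr]

theorem totalWeightMatrix_apply (e : G.edgeSet) (z : V ⊕ G.edgeSet) :
    totalWeightMatrix D e z =
      totalIncidenceMatrix G (D.target e) z - totalIncidenceMatrix G (D.source e) z := by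
  rcases z with w | y
  · have hne := D.source_ne_target e
    simp only [totalWeightMatrix, Matrix.of_apply, totalIncidenceMatrix_inl, eq_comm (a := w)]
    split_ifs <;> simp_all
  · simp only [totalWeightMatrix, Matrix.of_apply, totalIncidenceMatrix_inr]
    obtain rfl | hne := eq_or_ne y e
    · simp [D.mem_iff]
    · have hnot := D.source_notMem_of_target_mem hne
      split_ifs <;> simp_all

theorem totalWeightMatrix_mulVec [Fintype V] [Fintype G.edgeSet] (f : V ⊕ G.edgeSet → ℝ)
    (e : G.edgeSet) : (totalWeightMatrix D).mulVec f e =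
      vertexWeight f (D.target e) - vertexWeight f (D.source e) := by
  simp only [← totalIncidenceMatrix_mulVec, Matrix.mulVec, dotProduct, totalWeightMatrix_apply,
    sub_mul, Finset.sum_sub_distrib]

theorem totalWeightMatrix_inl_ne_zero_iff {e : G.edgeSet} {v : V} :
    totalWeightMatrix D e (Sum.inl v) ≠ 0 ↔ v ∈ (e : Sym2 V) := by
  have hne := D.source_ne_target e
  rw [D.mem_iff, totalWeightMatrix_apply, totalIncidenceMatrix_inl, totalIncidenceMatrix_inl]
  split_ifs <;> simp_all [eq_comm]

theorem totalWeightMatrix_col_inr (e : G.edgeSet) :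
    (totalWeightMatrix D).col (Sum.inr e) = (totalWeightMatrix D).col (Sum.inl (D.source e)) +
      (totalWeightMatrix D).col (Sum.inl (D.target e)) := by
  have hne := D.source_ne_target e
  have hincidence (v : V) : totalIncidenceMatrix G v (Sum.inr e) =
      totalIncidenceMatrix G v (Sum.inl (D.source e)) +
        totalIncidenceMatrix G v (Sum.inl (D.target e)) := by
    simp only [totalIncidenceMatrix_inl, totalIncidenceMatrix_inr, D.mem_iff]
    split_ifs <;> simp_all
  ext e'
  simp only [Matrix.col_apply, Pi.add_apply, totalWeightMatrix_apply, hincidence]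
  ring

theorem totalWeightChoosable_of_permanent_ne_zero [Finite V] [Fintype G.edgeSet]
    {ψ : V ⊕ G.edgeSet → ℕ+} {f : G.edgeSet → V ⊕ G.edgeSet}
    (hf : ((totalWeightMatrix D).submatrix id f).permanent ≠ 0)
    (hψ : ∀ z, Finset.card {e | f e = z} < ψ z) : TotalWeightChoosable G ψ := by
  have := Fintype.ofFinite V
  intro L hL
  obtain ⟨x, hx, hne⟩ := exists_forall_mulVec_ne_zero_of_permanent_ne_zero _ hf L
    fun z => (hψ z).trans_eq (hL z).symm
  refine ⟨x, fun u v huv heq => hne ⟨s(u, v), huv⟩ ?_, hx⟩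
  rw [totalWeightMatrix_mulVec, sub_eq_zero]
  rcases Sym2.eq_iff.mp (D.mk_eq ⟨s(u, v), huv⟩) with ⟨hs, ht⟩ | ⟨hs, ht⟩ <;> rw [hs, ht, heq]

theorem totalWeightPairChoosable_of_permanentIndex_lt [Finite V] [Fintype G.edgeSet] {k : ℕ+}
    (hk : permanentIndex (totalWeightMatrix D) < (k : ℕ)) : TotalWeightPairChoosable G k k := by
  obtain ⟨f, hf, hlt⟩ := exists_permanent_ne_zero_of_permanentIndex_lt hk
  refine totalWeightChoosable_of_permanent_ne_zero D hf fun z => ?_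
  rcases z with v | e <;> exact_mod_cast hlt _

end TotalWeightMatrix

section RootedForest

variable {V : Type*} {H : SimpleGraph V}

theorem eq_of_adj_of_dist_lt (hH : H.IsTree) {a v p q : V} (hp : H.Adj p v)
    (hpv : H.dist a p < H.dist a v) (hq : H.Adj q v) (hqv : H.dist a q < H.dist a v) : p = q := by
  obtain ⟨w, hw, -⟩ := hH.connected.exists_path_of_dist a v
  have hpenultimate {p : V} (hp : H.Adj p v) (hpv : H.dist a p < H.dist a v) :
      p = w.penultimate := by
    obtain ⟨u, hu, hlen⟩ := hH.connected.exists_path_of_dist a p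
    have hv : v ∉ u.support := fun hv => by
      classical
      exact (hpv.trans_le (SimpleGraph.dist_le (u.takeUntil v hv))).not_ge
        (hlen ▸ u.length_takeUntil_le_length hv)
    exact hH.isAcyclic.eq_penultimate_of_adj_end hw hp.symm
      (hH.isAcyclic.mem_support_of_ne_mem_support_of_adj_of_isPath hw hu hp.symm hv)
  exact (hpenultimate hp hpv).trans (hpenultimate hq hqv).symm

/-- A rooting of the graph `H`, recorded as a height of the vertices and a choice of the higher end
of each edge (the child; the other end is its parent), such that every vertex is the child in at
most one edge. The values of `child` outside the edge set of `H` are irrelevant. -/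
structure IsRooting (H : SimpleGraph V) (height : V → ℕ) (child : Sym2 V → V) : Prop where
  injOn : Set.InjOn child H.edgeSet
  exists_parent : ∀ e ∈ H.edgeSet, ∃ p, e = s(child e, p) ∧ height p < height (child e)

theorem IsRooting.mono {F : SimpleGraph V} {height : V → ℕ} {child : Sym2 V → V}
    (h : IsRooting F height child) (hle : H ≤ F) : IsRooting H height child :=
  have hsub := SimpleGraph.edgeSet_mono hle
  ⟨h.injOn.mono hsub, fun e he => h.exists_parent e (hsub he)⟩

theorem IsRooting.child_ne_of_height_eq_zero {height : V → ℕ} {child : Sym2 V → V} {r : V}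
    {e : Sym2 V} (h : IsRooting H height child) (hr : height r = 0) (he : e ∈ H.edgeSet) :
    child e ≠ r := by
  obtain ⟨p, -, hp⟩ := h.exists_parent e he
  exact fun heq => hp.not_ge (heq ▸ hr.le.trans (Nat.zero_le _))

theorem exists_isRooting_dist (hH : H.IsTree) (a : V) : ∃ child, IsRooting H (H.dist a) child := by
  have hparent (e : Sym2 V) :
      ∃ v, e ∈ H.edgeSet → ∃ p, e = s(v, p) ∧ H.dist a p < H.dist a v := by
    induction e with
    | h x y =>
      by_cases hadj : H.Adj x y
      · rcases (hH.dist_ne_of_adj a hadj).lt_or_gt with hlt | hlt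
        · exact ⟨y, fun _ => ⟨x, Sym2.eq_swap, hlt⟩⟩
        · exact ⟨x, fun _ => ⟨y, rfl, hlt⟩⟩
      · exact ⟨x, fun h => absurd h hadj⟩
  choose child hchild using hparent
  refine ⟨child, fun e he e' he' heq => ?_, hchild⟩
  obtain ⟨p, hep, hp⟩ := hchild e he
  obtain ⟨q, heq', hq⟩ := hchild e' he'
  rw [← heq] at heq' hq
  have hadj : H.Adj p (child e) := by
    rw [← SimpleGraph.mem_edgeSet, Sym2.eq_swap, ← hep]
    exact he
  have hadj' : H.Adj q (child e) := by
    rw [← SimpleGraph.mem_edgeSet, Sym2.eq_swap, ← heq']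
    exact he'
  rw [hep, heq', eq_of_adj_of_dist_lt hH hadj hp hadj' hq]

theorem exists_isRooting_of_isAcyclic (hH : H.IsAcyclic) (a : V) :
    ∃ height child, height a = 0 ∧ IsRooting H height child := by
  have : Nonempty V := ⟨a⟩
  obtain ⟨T, hle, -, hT⟩ :=
    SimpleGraph.connected_top.exists_isTree_le_of_le_of_isAcyclic le_top hH
  obtain ⟨child, h⟩ := exists_isRooting_dist hT a
  exact ⟨T.dist a, child, SimpleGraph.dist_self, h.mono hle⟩

end RootedForest

section AlmostForest

variable {V : Type*} {G : SimpleGraph V}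

theorem injective_update_of_injOn {α β : Type*} [DecidableEq α] {f : α → β} {a : α} {b : β}
    (hf : Set.InjOn f {a}ᶜ) (hb : ∀ x ≠ a, f x ≠ b) :
    Function.Injective (Function.update f a b) := by
  intro x y hxy
  by_cases hx : x = a <;> by_cases hy : y = a <;>
    simp only [Function.update_apply, hx, hy, if_true, if_false] at hxy
  · exact hx.trans hy.symm
  · exact absurd hxy.symm (hb y hy)
  · exact absurd hxy (hb x hx)
  · exact hf hx hy hxy

theorem coe_mem_edgeSet_deleteEdges_singleton {e e₀ : G.edgeSet} :
    (e : Sym2 V) ∈ (G.deleteEdges {(e₀ : Sym2 V)}).edgeSet ↔ e ≠ e₀ := by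
  simp [Subtype.ext_iff]

theorem permanent_ne_zero_of_isRooting [DecidableEq V] [Fintype G.edgeSet] (D : GraphOrientation G)
    {e₀ : G.edgeSet} {height : V → ℕ} {child : Sym2 V → V}
    (h : IsRooting (G.deleteEdges {(e₀ : Sym2 V)}) height child)
    (hroot : height (D.source e₀) = 0) {v : G.edgeSet → V} (hv₀ : v e₀ = D.target e₀)
    (hv : ∀ e ≠ e₀, v e = child e) :
    ((totalWeightMatrix D).submatrix id (Sum.inl ∘ v)).permanent ≠ 0 := by
  have hparent (e : G.edgeSet) (he : e ≠ e₀) :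
      ∃ p, (e : Sym2 V) = s(v e, p) ∧ height p < height (v e) := by
    rw [hv e he]
    exact h.exists_parent e (coe_mem_edgeSet_deleteEdges_singleton.mpr he)
  have hsource (e : G.edgeSet) : v e ≠ D.source e₀ := by
    obtain rfl | he := eq_or_ne e e₀
    · exact hv₀ ▸ (D.source_ne_target e).symm
    · exact hv e he ▸ h.child_ne_of_height_eq_zero hroot
        (coe_mem_edgeSet_deleteEdges_singleton.mpr he)
  refine permanent_ne_zero_of_rank_lt_or_col_eq _ (height ∘ v) (fun e => ?_) fun e e' hne => ?_
  · refine (totalWeightMatrix_inl_ne_zero_iff D).mpr ?_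
    obtain rfl | he := eq_or_ne e e₀
    · exact D.mem_iff.mpr (Or.inr hv₀)
    · obtain ⟨p, hep, -⟩ := hparent e he
      exact hep ▸ Sym2.mem_mk_left _ _
  · have hmem : v e' ∈ (e : Sym2 V) := (totalWeightMatrix_inl_ne_zero_iff D).mp hne
    suffices height (v e') < height (v e) ∨ v e' = v e from
      this.imp_right fun heq => ⟨congrArg height heq, by ext; simp [heq]⟩
    obtain rfl | he := eq_or_ne e e₀
    · exact Or.inr (((D.mem_iff.mp hmem).resolve_left (hsource e')).trans hv₀.symm)
    · obtain ⟨p, hep, hp⟩ := hparent e he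
      rw [hep, Sym2.mem_iff] at hmem
      exact hmem.symm.imp_left fun heq => (congrArg height heq).trans_lt hp

theorem exists_injective_permanent_ne_zero [DecidableEq V] [Fintype G.edgeSet]
    (D : GraphOrientation G) (e₀ : G.edgeSet)
    (hG : (G.deleteEdges {(e₀ : Sym2 V)}).IsAcyclic) :
    ∃ f : G.edgeSet → V ⊕ G.edgeSet, Function.Injective f ∧
      ((totalWeightMatrix D).submatrix id f).permanent ≠ 0 := by
  obtain ⟨height, child, hroot, h⟩ := exists_isRooting_of_isAcyclic hG (D.source e₀)
  set f : G.edgeSet → V ⊕ G.edgeSet := Sum.inl ∘ fun e => child e with hf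
  have hinj : Set.InjOn f {e₀}ᶜ := fun e he e' he' heq =>
    Subtype.ext (h.injOn (coe_mem_edgeSet_deleteEdges_singleton.mpr he)
      (coe_mem_edgeSet_deleteEdges_singleton.mpr he') (Sum.inl_injective heq))
  have hsource (e : G.edgeSet) (he : e ≠ e₀) : f e ≠ Sum.inl (D.source e₀) :=
    Sum.inl_injective.ne <| h.child_ne_of_height_eq_zero hroot <|
      coe_mem_edgeSet_deleteEdges_singleton.mpr he
  have htarget : ((totalWeightMatrix D).submatrix id
      (Function.update f e₀ (Sum.inl (D.target e₀)))).permanent ≠ 0 := by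
    rw [hf, ← Function.comp_update]
    exact permanent_ne_zero_of_isRooting D h hroot (Function.update_self ..)
      fun _ he => Function.update_of_ne he ..
  have hadd : ((totalWeightMatrix D).submatrix id
        (Function.update f e₀ (Sum.inr e₀))).permanent =
      ((totalWeightMatrix D).submatrix id
        (Function.update f e₀ (Sum.inl (D.source e₀)))).permanent +
      ((totalWeightMatrix D).submatrix id
        (Function.update f e₀ (Sum.inl (D.target e₀)))).permanent := by
    simp only [submatrix_id_update, totalWeightMatrix_col_inr, permanent_updateCol_add]
  by_cases hper : ((totalWeightMatrix D).submatrix id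
      (Function.update f e₀ (Sum.inl (D.source e₀)))).permanent = 0
  · refine ⟨_, injective_update_of_injOn (b := Sum.inr e₀) hinj fun _ _ => Sum.inl_ne_inr, ?_⟩
    rwa [hadd, hper, zero_add]
  · exact ⟨_, injective_update_of_injOn hinj hsource, hper⟩

theorem exists_isAcyclic_deleteEdges_of_existsUnique_cycle
    (hG : ∃! H : G.Subgraph, ∃ (v : V) (c : G.Walk v v), c.IsCycle ∧ c.toSubgraph = H) :
    ∃ e ∈ G.edgeSet, (G.deleteEdges {e}).IsAcyclic := by
  obtain ⟨H, ⟨v, c, hc, hcH⟩, huniq⟩ := hG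
  obtain ⟨e, he⟩ : ∃ e, e ∈ c.edges :=
    List.exists_mem_of_ne_nil _ fun h => hc.not_nil (SimpleGraph.Walk.edges_eq_nil.mp h)
  refine ⟨e, c.edges_subset_edgeSet he, fun w c' hc' => ?_⟩
  have hle := G.deleteEdges_le {e}
  have hsame : (c'.mapLe hle).toSubgraph = c.toSubgraph :=
    (huniq _ ⟨w, c'.mapLe hle, hc'.mapLe hle, rfl⟩).trans hcH.symm
  have hmem : e ∈ c'.edges := by
    rwa [← SimpleGraph.Walk.edges_mapLe_eq_edges hle, ← SimpleGraph.Walk.mem_edges_toSubgraph,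
      hsame, SimpleGraph.Walk.mem_edges_toSubgraph]
  have hdel := c'.edges_subset_edgeSet hmem
  rw [SimpleGraph.edgeSet_deleteEdges] at hdel
  exact hdel.2 rfl

theorem exists_isAcyclic_deleteEdges_of_connected_of_card [Fintype V] [Fintype G.edgeSet]
    (hG : G.Connected) (hcard : G.edgeFinset.card = Fintype.card V) :
    ∃ e ∈ G.edgeSet, (G.deleteEdges {e}).IsAcyclic := by
  classical
  have hnot : ¬ G.IsAcyclic := fun h => by
    have := SimpleGraph.IsTree.card_edgeFinset ⟨hG, h⟩
    omega
  rw [SimpleGraph.isAcyclic_iff_forall_isBridge] at hnot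
  push Not at hnot
  obtain ⟨e, he, hbridge⟩ := hnot
  have hconn : (G.deleteEdges {e}).Connected := by
    induction e with
    | h x y => exact hG.connected_delete_edge_of_not_isBridge hbridge
  refine ⟨e, he, (SimpleGraph.isTree_iff_connected_and_card.mpr ⟨hconn, ?_⟩).isAcyclic⟩
  rw [SimpleGraph.edgeSet_deleteEdges, Nat.card_coe_set_eq, Set.ncard_sdiff_singleton_add_one he,
    ← SimpleGraph.coe_edgeFinset, Set.ncard_coe_finset, hcard, Nat.card_eq_fintype_card]

end AlmostForest

theorem theorem3p1_general {V : Type*} [Finite V] [DecidableEq V] {G : SimpleGraph V}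
    [Fintype G.edgeSet] {e : Sym2 V} (he : e ∈ G.edgeSet) (hG : (G.deleteEdges {e}).IsAcyclic) :
    (∀ D : GraphOrientation G, permanentIndex (totalWeightMatrix D) = 1) ∧
      TotalWeightPairChoosable G 2 2 := by
  have hindex (D : GraphOrientation G) : permanentIndex (totalWeightMatrix D) = 1 := by
    obtain ⟨f, hf, hper⟩ := exists_injective_permanent_ne_zero D ⟨e, he⟩ hG
    have : Nonempty G.edgeSet := ⟨e, he⟩
    exact (permanentIndex_le_one_of_injective hf hper).antisymm one_le_permanentIndex
  obtain ⟨D⟩ := GraphOrientation.nonempty G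
  have hlt : permanentIndex (totalWeightMatrix D) < ((2 : ℕ+) : ℕ) := by
    rw [hindex D]
    exact_mod_cast Nat.one_lt_two
  exact ⟨hindex, totalWeightPairChoosable_of_permanentIndex_lt D hlt⟩

theorem theorem3p1 {V : Type*} [Fintype V] [DecidableEq V] (G : SimpleGraph V)
    [DecidableRel G.Adj] :
    (IsUnicyclic G →
      (∀ D : GraphOrientation G, permanentIndex (totalWeightMatrix D) = 1) ∧
        TotalWeightPairChoosable G 2 2) ∧
    (G.Connected → G.edgeFinset.card = Fintype.card V → TotalWeightPairChoosable G 2 2) := by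
  refine ⟨fun hG => ?_, fun hconn hcard => ?_⟩
  · obtain ⟨e, he, hacyclic⟩ := exists_isAcyclic_deleteEdges_of_existsUnique_cycle hG.2
    exact theorem3p1_general he hacyclic
  · obtain ⟨e, he, hacyclic⟩ := exists_isAcyclic_deleteEdges_of_connected_of_card hconn hcard
    exact (theorem3p1_general he hacyclic).2
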